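/- Let $n\ge 1$ and let $f_1,\dots,f_n$ be pairwise commuting invertible affine maps of $\mathbb{C}^n$ (maps $x\mapsto Ax+a$ with $A\in GL(n,\mathbb{C})$, $a\in\mathbb{C}^n$). Let $\mathcal{G}$ be either the semigroup or the group, under composition, generated by $f_1,\dots,f_n$ (it is automatically abelian). Then $\mathcal{G}$ has no dense orbit: for every $v\in\mathbb{C}^n$ the set $\mathcal{G}(v)=\{f(v): f\in\mathcal{G}\}$ is not dense in $\mathbb{C}^n$. -/

import Mathlib

/-- The orbit `𝒢(v) = {f(v) : f ∈ 𝒢}` of a point `v ∈ ℂⁿ` under a set `𝒢` of (bundled) self-maps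
of `ℂⁿ`. -/
def affineOrbit {n : ℕ} {F : Type*} [FunLike F (Fin n → ℂ) (Fin n → ℂ)] (𝒢 : Set F)
    (v : Fin n → ℂ) : Set (Fin n → ℂ) :=
  {x | ∃ f ∈ 𝒢, f v = x}

/-- `𝒢` is hypercyclic: it has a dense orbit in `ℂⁿ`. -/
def IsHypercyclic {n : ℕ} {F : Type*} [FunLike F (Fin n → ℂ) (Fin n → ℂ)] (𝒢 : Set F) : Prop :=
  ∃ v : Fin n → ℂ, Dense (affineOrbit 𝒢 v)

/-! Affine maps of ℂⁿ act as linear maps of ℂⁿ × ℂ preserving the last coordinate; let A be the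
commutative algebra spanned by the lifted group. A dense orbit of v makes evaluation at (v, 1) an
isomorphism A ≅ ℂⁿ × ℂ, so the group is dense in the hyperplane χ = 1 of a character χ whose kernel
has dimension n.

Units of A have logarithms (`IsUnit.exists_exp_eq`), so the group is the exponential of a subgroup
of ker χ with n generators. The periods of exp in ker χ form a discrete group whose real span is
totally real (by Liouville), hence of rank at most n. Together these are at most 2n = dim_ℝ ker χ
generators, so some nonzero real functional on ker χ is integral on all of them. As exp is open,
this contradicts density. -/

open NormedSpace Filter Topology

/-! ### Real linear algebra: integral functionals and totally real subspaces. -/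

/-- A family of at most `dim K` vectors of a nonzero real space `K` takes integer values under some
linear functional which does not vanish on `K`. -/
theorem exists_functional_integer_valued {V : Type*} [AddCommGroup V] [Module ℝ V]
    (K : Submodule ℝ V) [FiniteDimensional ℝ K] {ι : Type*} [Fintype ι] (b : ι → V)
    (hb : ∀ i, b i ∈ K) (hcard : Fintype.card ι ≤ Module.finrank ℝ K)
    (hK : 0 < Module.finrank ℝ K) :
    ∃ φ : V →ₗ[ℝ] ℝ, (∃ v ∈ K, φ v = 1 / 2) ∧ ∀ i, ∃ m : ℤ, φ (b i) = m := by
  classical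
  let c : ι → K := fun i => ⟨b i, hb i⟩
  suffices h : ∃ ψ : K →ₗ[ℝ] ℝ, ψ ≠ 0 ∧ ∀ i, ∃ m : ℤ, ψ (c i) = m by
    obtain ⟨ψ, h0, hm⟩ := h
    obtain ⟨φ, hφ⟩ := LinearMap.exists_extend ψ
    have hφ' : ∀ x : K, φ x = ψ x := fun x => by rw [← hφ]; rfl
    obtain ⟨u, hu⟩ : ∃ u, ψ u ≠ 0 := by
      by_contra! h
      exact h0 (LinearMap.ext h)
    refine ⟨φ, ⟨(1 / (2 * ψ u)) • u, K.smul_mem _ u.2, ?_⟩, fun i => ?_⟩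
    · rw [map_smul, hφ', smul_eq_mul]; field_simp
    · obtain ⟨m, h⟩ := hm i
      exact ⟨m, by rw [← h, ← hφ' (c i)]⟩
  -- If the vectors span, the count makes them a basis and a coordinate works; otherwise some
  -- nonzero functional kills them all.
  by_cases hs : Submodule.span ℝ (Set.range c) = ⊤
  · have hc : Fintype.card ι = Module.finrank ℝ K := by
      refine le_antisymm hcard ?_
      rw [← finrank_top ℝ K, ← hs]
      exact finrank_range_le_card c
    let B := basisOfTopLeSpanOfCardEqFinrank c hs.ge hc
    have hB : ∀ i, B i = c i := fun i => by simp [B]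
    have : Nonempty ι := Fintype.card_pos_iff.1 (hc ▸ hK)
    obtain ⟨j⟩ := this
    refine ⟨B.coord j, fun h => ?_, fun i => ⟨if i = j then 1 else 0, ?_⟩⟩
    · simpa using LinearMap.congr_fun h (B j)
    · rw [← hB, Module.Basis.coord_apply, B.repr_self, Finsupp.single_apply]
      split_ifs <;> simp
  · obtain ⟨ψ, h0, hψ⟩ := Submodule.exists_le_ker_of_lt_top _ (lt_top_iff_ne_top.2 hs)
    exact ⟨ψ, h0, fun i => ⟨0, by simpa using hψ (Submodule.subset_span ⟨i, rfl⟩)⟩⟩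

/-- A totally real subspace has real dimension at most the complex dimension of any complex
subspace that contains it. -/
theorem finrank_le_of_totallyReal {V : Type*} [AddCommGroup V] [Module ℂ V]
    (K : Submodule ℂ V) [FiniteDimensional ℂ K] (W : Submodule ℝ V)
    (hWK : W ≤ K.restrictScalars ℝ) (hW : ∀ x ∈ W, Complex.I • x ∈ W → x = 0) :
    Module.finrank ℝ W ≤ Module.finrank ℂ K := by
  have : FiniteDimensional ℝ (K.restrictScalars ℝ) := FiniteDimensional.complexToReal K
  have hK : Module.finrank ℝ (K.restrictScalars ℝ) = 2 * Module.finrank ℂ K :=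
    finrank_real_of_complex K
  have : FiniteDimensional ℝ W := Submodule.finiteDimensional_of_le hWK
  let J : V →ₗ[ℝ] V := (LinearMap.lsmul ℂ V Complex.I).restrictScalars ℝ
  have hJ : ∀ x, J x = Complex.I • x := fun x => rfl
  have hJJ : ∀ x, J (J x) = -x := fun x => by simp [hJ, smul_smul]
  have hinj : Function.Injective J := fun x y h => by
    simpa [hJJ] using congrArg J h
  have hdisj : W ⊓ W.map J = ⊥ := by
    rw [eq_bot_iff]
    rintro _ ⟨h1, ⟨y, hy, rfl⟩⟩
    simp [hW y hy h1]
  have hsum := Submodule.finrank_sup_add_finrank_inf_eq W (W.map J)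
  have hmap : Module.finrank ℝ (W.map J) = Module.finrank ℝ W :=
    (Submodule.equivMapOfInjective J hinj W).finrank_eq.symm
  -- W and iW are independent of equal dimension inside K, so 2 dim W ≤ 2 dim_ℂ K.
  have hle : W ⊔ W.map J ≤ K.restrictScalars ℝ := by
    refine sup_le hWK ?_
    rintro _ ⟨y, hy, rfl⟩
    exact K.smul_mem _ (hWK hy)
  have := Submodule.finrank_mono hle
  rw [hdisj, finrank_bot, hmap] at hsum
  omega

/-! ### The exponential of a commutative Banach algebra. -/

/-- A bad z is nonzero and makes -1/z an eigenvalue of multiplication by x. -/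
theorem finite_not_isUnit_one_add_smul {A : Type*} [CommRing A] [Algebra ℂ A]
    [FiniteDimensional ℂ A] (x : A) :
    {z : ℂ | ¬ IsUnit (1 + z • x)}.Finite := by
  have hspec : (spectrum ℂ (Algebra.lmul ℂ A x)).Finite := Module.End.finite_spectrum _
  refine (hspec.image fun z => -z⁻¹).subset fun z hz => ?_
  have hz0 : z ≠ 0 := by
    rintro rfl
    exact hz (by simp)
  refine ⟨-z⁻¹, fun h => hz ?_, by simp⟩
  have e : algebraMap ℂ (Module.End ℂ A) (-z⁻¹) - Algebra.lmul ℂ A x =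
      Algebra.lmul ℂ A (algebraMap ℂ A (-z⁻¹) - x) := by
    rw [map_sub, AlgHom.commutes]
  rw [spectrum.mem_resolventSet_iff, e, Algebra.lmul_isUnit_iff] at h
  have e2 : 1 + z • x = algebraMap ℂ A (-z) * (algebraMap ℂ A (-z⁻¹) - x) := by
    rw [mul_sub, ← map_mul, ← Algebra.smul_def]
    simp [hz0]
  rw [e2]
  exact ((IsUnit.mk0 _ (neg_ne_zero.2 hz0)).map (algebraMap ℂ A)).mul h

theorem eventually_exp_eq_one_imp_eq_zero {A : Type*} [NormedCommRing A]
    [NormedAlgebra ℂ A] [CompleteSpace A] : ∀ᶠ x : A in 𝓝 0, exp x = 1 → x = 0 := by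
  have h := hasFDerivAt_exp_zero (𝕂 := ℂ) (𝔸 := A)
  have h2 := h.eventually_ne (c := 1) ⟨1, AntilipschitzWith.id⟩
  rw [eventually_nhdsWithin_iff] at h2
  filter_upwards [h2] with x hx hx1
  by_contra h
  exact hx h hx1

section Exp

variable {A : Type*} [NormedCommRing A] [NormedAlgebra ℚ A] [NormedAlgebra ℂ A] [CompleteSpace A]

/-- The inverse function theorem gives openness at 0; exp y = exp x * exp (y - x) carries it to
every x. -/
theorem isOpenMap_exp : IsOpenMap (exp : A → A) := by
  refine IsOpenMap.of_nhds_le fun x => ?_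
  have h0 : map (exp : A → A) (𝓝 0) = 𝓝 1 := by
    have h := hasStrictFDerivAt_exp_zero (𝕂 := ℂ) (𝔸 := A)
    have := HasStrictFDerivAt.map_nhds_eq_of_equiv (f' := ContinuousLinearEquiv.refl ℂ A) h
    rwa [exp_zero] at this
  have hx : (exp : A → A) = (fun y => exp x * y) ∘ exp ∘ (fun y => y - x) := by
    funext y
    simp [← exp_add]
  have h1 : map (fun y => y - x) (𝓝 x) = 𝓝 (0 : A) := by
    have := (Homeomorph.subRight x).map_nhds_eq x
    simpa only [Homeomorph.coe_subRight, sub_self] using this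
  obtain ⟨u, hu⟩ := isUnit_exp x
  have h2 : map (fun y => exp x * y) (𝓝 (1 : A)) = 𝓝 (exp x) := by
    rw [← hu]
    have := (Homeomorph.smul u).map_nhds_eq (1 : A)
    rwa [Homeomorph.smul_apply, Units.smul_def, smul_eq_mul, mul_one] at this
  conv_rhs => rw [hx]
  rw [← Filter.map_map, ← Filter.map_map, h1, h0, h2]

/-- In a finite-dimensional commutative complex algebra every unit has a logarithm. -/
theorem IsUnit.exists_exp_eq [FiniteDimensional ℂ A] {g : A} (hg : IsUnit g) :
    ∃ x, exp x = g := by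
  let R : Set A := Set.range exp
  have hR : IsOpen R := isOpenMap_exp.isOpen_range
  -- The units outside the subgroup R form a union of cosets of R, hence are open as well.
  let T : Set A := {y | IsUnit y ∧ y ∉ R}
  have hT : IsOpen T := by
    have : T = ⋃ u : {u : Aˣ // (u : A) ∉ R}, (fun y => (u.1 : A) * y) '' R := by
      ext y
      simp only [Set.mem_iUnion, T, Set.mem_ofPred_eq]
      constructor
      · rintro ⟨⟨u, rfl⟩, hu⟩
        exact ⟨⟨u, hu⟩, 1, ⟨0, exp_zero⟩, mul_one _⟩
      · rintro ⟨⟨u, hu⟩, _, ⟨x, rfl⟩, rfl⟩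
        refine ⟨u.isUnit.mul (isUnit_exp x), fun ⟨y, hy⟩ => hu ⟨y - x, ?_⟩⟩
        rw [sub_eq_add_neg, exp_add, hy, mul_assoc, ← exp_add]
        simp
    rw [this]
    exact isOpen_iUnion fun u => (Homeomorph.smul u.1).isOpenMap _ hR
  -- The complex line through 1 and g meets the non-units in finitely many points, so its units form
  -- a connected set.
  let S : Set ℂ := {z | IsUnit (1 + z • (g - 1))}
  have hS : IsPreconnected S := by
    have h := (finite_not_isUnit_one_add_smul (g - 1)).countable.isConnected_compl_of_one_lt_rank
      (by rw [Complex.rank_real_complex]; norm_num)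
    convert! h.isPreconnected using 1
    ext z
    simp [S]
  have hcont : Continuous fun z : ℂ => 1 + z • (g - 1) := by fun_prop
  have him := hS.image _ hcont.continuousOn
  have hsub := him.subset_left_of_subset_union hR hT
    (Set.disjoint_left.2 fun y hy hy' => hy'.2 hy)
    (by
      rintro _ ⟨z, hz, rfl⟩
      by_cases h : (1 + z • (g - 1)) ∈ R
      · exact Or.inl h
      · exact Or.inr ⟨hz, h⟩)
    ⟨1, (⟨0, by simp [S], by simp⟩ : ∃ z ∈ S, 1 + z • (g - 1) = 1), ⟨0, exp_zero⟩⟩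
  exact hsub (show g ∈ _ from ⟨1, by simpa [S] using hg, by simp⟩)

/-- Along the real span of periods of `exp`, the exponential is bounded on real lines. -/
theorem exists_bound_exp_smul_of_mem_span_periods {y : A}
    (hy : y ∈ Submodule.span ℝ {x : A | exp x = 1}) : ∃ C, ∀ t : ℝ, ‖exp (t • y)‖ ≤ C := by
  induction hy using Submodule.span_induction with
  | mem x hx =>
    have hcont : Continuous fun t : ℝ => exp (t • x) := exp_continuous.comp (by fun_prop)
    have hper : Function.Periodic (fun t : ℝ => exp (t • x)) 1 := fun t => by
      have hx : exp x = 1 := hx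
      simp [add_smul, exp_add, hx]
    obtain ⟨C, hC⟩ := (isCompact_Icc (a := (0 : ℝ)) (b := 1)).exists_bound_of_continuousOn
      hcont.continuousOn
    refine ⟨C, fun t => ?_⟩
    obtain ⟨s, hs, hst⟩ := hper.exists_mem_Ico₀ one_pos t
    have : exp (t • x) = exp (s • x) := hst
    rw [this]
    exact hC s ⟨hs.1, hs.2.le⟩
  | zero => exact ⟨‖(1 : A)‖, fun t => by simp [exp_zero]⟩
  | add x y _ _ hx hy =>
    obtain ⟨C, hC⟩ := hx
    obtain ⟨D, hD⟩ := hy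
    refine ⟨C * D, fun t => ?_⟩
    rw [smul_add, exp_add]
    exact (norm_mul_le _ _).trans
      (mul_le_mul (hC t) (hD t) (norm_nonneg _) ((norm_nonneg _).trans (hC t)))
  | smul r x _ hx =>
    obtain ⟨C, hC⟩ := hx
    exact ⟨C, fun t => by rw [smul_smul]; exact hC _⟩

/-- The real span of the periods of `exp` is totally real. -/
theorem eq_zero_of_mem_span_periods {y : A}
    (hy : y ∈ Submodule.span ℝ {x : A | exp x = 1})
    (hIy : Complex.I • y ∈ Submodule.span ℝ {x : A | exp x = 1}) : y = 0 := by
  obtain ⟨C, hC⟩ := exists_bound_exp_smul_of_mem_span_periods hy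
  obtain ⟨D, hD⟩ := exists_bound_exp_smul_of_mem_span_periods hIy
  have hder : ∀ z : ℂ, HasDerivAt (fun z : ℂ => exp (z • y)) (exp (z • y) * y) z :=
    fun z => hasDerivAt_exp_smul_const y z
  -- z ↦ exp (z • y) is entire and bounded, hence constant by Liouville; its derivative at 0 is y.
  have hb : Bornology.IsBounded (Set.range fun z : ℂ => exp (z • y)) := by
    refine isBounded_iff_forall_norm_le.2 ⟨C * D, ?_⟩
    rintro _ ⟨z, rfl⟩
    have : z • y = z.re • y + z.im • (Complex.I • y) := by
      conv_lhs => rw [← Complex.re_add_im z, add_smul, mul_smul]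
      simp
    simp only [this, exp_add]
    exact (norm_mul_le _ _).trans
      (mul_le_mul (hC _) (hD _) (norm_nonneg _) ((norm_nonneg _).trans (hC 0)))
  obtain ⟨c, hc⟩ := Differentiable.exists_eq_const_of_bounded
    (fun z => (hder z).differentiableAt) hb
  have h1 := hder 0
  rw [hc] at h1
  simpa [exp_zero] using h1.unique (hasDerivAt_const 0 c)

/-- The periods of `exp` that are killed by a character `χ`. -/
def kerPeriods (χ : A →ₐ[ℂ] ℂ) : Submodule ℤ A :=
  AddSubgroup.toIntSubmodule
    { carrier := {x | exp x = 1 ∧ χ x = 0}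
      add_mem' := fun {x y} hx hy => by
        refine ⟨?_, by rw [map_add, hx.2, hy.2, add_zero]⟩
        rw [exp_add, hx.1, hy.1, one_mul]
      zero_mem' := ⟨exp_zero, map_zero _⟩
      neg_mem' := fun {x} hx => by
        refine ⟨?_, by rw [map_neg, hx.2, neg_zero]⟩
        have h : exp (x + -x) = exp x * exp (-x) := exp_add
        rw [hx.1, one_mul, add_neg_cancel, exp_zero] at h
        exact h.symm }

instance discreteTopology_kerPeriods (χ : A →ₐ[ℂ] ℂ) : DiscreteTopology (kerPeriods χ) := by
  rw [discreteTopology_iff_isOpen_singleton_zero]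
  rw [isOpen_iff_mem_nhds]
  rintro x rfl
  have h : Tendsto (fun x : kerPeriods χ => (x : A)) (𝓝 0) (𝓝 0) := by
    simpa using (continuous_subtype_val (p := (· ∈ kerPeriods χ))).tendsto 0
  filter_upwards [h.eventually eventually_exp_eq_one_imp_eq_zero] with x hx
  exact Subtype.ext (hx x.2.1)

/-- For a discrete subgroup the ℤ-rank is the real dimension of its span, here totally real inside
ker χ. -/
theorem finrank_kerPeriods_le [FiniteDimensional ℂ A] (χ : A →ₐ[ℂ] ℂ) :
    Module.finrank ℤ (kerPeriods χ) ≤ Module.finrank ℂ (LinearMap.ker χ.toLinearMap) := by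
  have : FiniteDimensional ℝ A := FiniteDimensional.complexToReal A
  have hspan : Submodule.span ℤ (kerPeriods χ : Set A) = kerPeriods χ := Submodule.span_eq _
  have h := Real.finrank_eq_int_finrank_of_discrete (s := (kerPeriods χ : Set A))
    (by rw [hspan]; infer_instance)
  rw [Set.finrank, Set.finrank, hspan] at h
  rw [← h]
  refine finrank_le_of_totallyReal _ _ (Submodule.span_le.2 fun x hx => hx.2) fun x hx hIx => ?_
  have hle := Submodule.span_mono (R := ℝ) (s := (kerPeriods χ : Set A))
    (t := {x : A | exp x = 1}) fun x hx => hx.1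
  exact eq_zero_of_mem_span_periods (hle hx) (hle hIx)

/-- The exponential of a subgroup with at most `dim ker χ` generators, all in `ker χ`, is not dense
in the affine hyperplane `χ = 1`. -/
theorem not_subset_closure_exp_image [FiniteDimensional ℂ A] (χ : A →ₐ[ℂ] ℂ) {n : ℕ}
    (hn : 1 ≤ n) (hdim : n ≤ Module.finrank ℂ (LinearMap.ker χ.toLinearMap)) (a : Fin n → A)
    (ha : ∀ i, χ (a i) = 0) :
    ¬ {x | χ x = 1} ⊆ closure (exp '' (AddSubgroup.closure (Set.range a) : Set A)) := by
  intro hsub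
  have : FiniteDimensional ℝ A := FiniteDimensional.complexToReal A
  have hχc : Continuous χ := χ.toLinearMap.continuous_of_finiteDimensional
  have hχexp : ∀ x, χ (exp x) = Complex.exp (χ x) := fun x => by
    rw [map_exp χ hχc, Complex.exp_eq_exp_ℂ]
  let K := LinearMap.ker χ.toLinearMap
  have hK : Module.finrank ℝ (K.restrictScalars ℝ) = 2 * Module.finrank ℂ K :=
    finrank_real_of_complex K
  let B := Module.finBasis ℤ (kerPeriods χ)
  have hrank : _ ≤ Module.finrank ℂ K := finrank_kerPeriods_le χ
  change n ≤ Module.finrank ℂ K at hdim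
  obtain ⟨φ, ⟨v, hvK, hv⟩, hint⟩ := exists_functional_integer_valued (K.restrictScalars ℝ)
    (Sum.elim a fun i => (B i : A))
    (by rintro (i | i); exacts [ha i, (B i).2.2])
    (by rw [hK, Fintype.card_sum, Fintype.card_fin, Fintype.card_fin]; omega) (by omega)
  have hφc : Continuous φ := φ.continuous_of_finiteDimensional
  let Z : AddSubgroup A := (Int.castAddHom ℝ).range.comap φ.toAddMonoidHom
  have hZ : ∀ x, x ∈ Z ↔ ∃ m : ℤ, (m : ℝ) = φ x := fun x => Iff.rfl
  have haZ : AddSubgroup.closure (Set.range a) ≤ Z := by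
    rw [AddSubgroup.closure_le]
    rintro _ ⟨i, rfl⟩
    obtain ⟨m, hm⟩ := hint (Sum.inl i)
    exact ⟨m, hm.symm⟩
  have hMZ : kerPeriods χ ≤ AddSubgroup.toIntSubmodule Z := by
    intro x hx
    have h1 : (⟨x, hx⟩ : kerPeriods χ) ∈ Submodule.span ℤ (Set.range B) := by
      rw [B.span_eq]; trivial
    have h2 : Submodule.span ℤ (Set.range B) ≤
        (AddSubgroup.toIntSubmodule Z).comap (kerPeriods χ).subtype := by
      rw [Submodule.span_le]
      rintro _ ⟨i, rfl⟩
      obtain ⟨m, hm⟩ := hint (Sum.inr i)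
      exact ⟨m, hm.symm⟩
    exact h2 h1
  have haχ : ∀ y ∈ AddSubgroup.closure (Set.range a), χ y = 0 := by
    intro y hy
    have : AddSubgroup.closure (Set.range a) ≤ K.toAddSubgroup := by
      rw [AddSubgroup.closure_le]
      rintro _ ⟨i, rfl⟩
      exact ha i
    exact this hy
  -- Subtracting the scalar χ x projects A onto ker χ, so W is open in all of A and `isOpenMap_exp`
  -- applies.
  let W : Set A := {x | φ (x - algebraMap ℂ A (χ x)) ∈ Set.Ioo (0 : ℝ) 1}
  have hW : IsOpen W := isOpen_Ioo.preimage
    (hφc.comp (continuous_id.sub ((continuous_algebraMap ℂ A).comp hχc)))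
  have hvχ : χ v = 0 := hvK
  have hvW : v ∈ W := by
    simp only [W, Set.mem_ofPred_eq, hvχ, map_zero, sub_zero, hv]
    norm_num
  have hcl : exp v ∈ closure (exp '' (AddSubgroup.closure (Set.range a) : Set A)) :=
    hsub (by simp [hχexp, hvχ])
  obtain ⟨_, ⟨x, hxW, rfl⟩, ⟨y, hy, hyx⟩⟩ :=
    mem_closure_iff.1 hcl _ (isOpenMap_exp W hW) ⟨v, hvW, rfl⟩
  set x' := x - algebraMap ℂ A (χ x) with hx'
  have hχx : Complex.exp (χ x) = 1 := by
    rw [← hχexp, ← hyx, hχexp, haχ y hy, Complex.exp_zero]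
  have hexpx' : exp (x' - y) = 1 := by
    have h1 : x = x' - y + (y + algebraMap ℂ A (χ x)) := by rw [hx']; ring
    have h2 : exp (algebraMap ℂ A (χ x)) = 1 := by
      rw [← algebraMap_exp_comm, ← Complex.exp_eq_exp_ℂ, hχx, map_one]
    have h3 : exp x = exp (x' - y) * (exp y * exp (algebraMap ℂ A (χ x))) := by
      rw [← exp_add, ← exp_add, ← h1]
    rw [h2, mul_one, hyx] at h3
    obtain ⟨u, hu⟩ := isUnit_exp x
    rw [← hu] at h3
    exact (u.isUnit.mul_right_cancel (by rw [one_mul]; exact h3)).symm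
  -- So x' is a period plus an element of the subgroup: φ x' is an integer strictly between 0 and 1.
  have hmem : x' - y ∈ kerPeriods χ := ⟨hexpx', by simp [hx', haχ y hy]⟩
  have hx'Z : x' ∈ Z := by
    have := Z.add_mem (hMZ hmem) (haZ hy)
    rwa [sub_add_cancel] at this
  obtain ⟨m, hm⟩ := (hZ _).1 hx'Z
  have h01 : φ x' ∈ Set.Ioo (0 : ℝ) 1 := hxW
  rw [← hm] at h01
  have h0 : (0 : ℤ) < m := by exact_mod_cast h01.1
  have h1 : m < (1 : ℤ) := by exact_mod_cast h01.2
  omega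

end Exp
/-- The image of a group with at most `dim ker χ` generators in a finite-dimensional commutative
complex algebra is not dense in the affine hyperplane `χ = 1`. -/
theorem not_subset_closure_range_of_fg {A : Type*} [NormedCommRing A] [NormedAlgebra ℂ A]
    [FiniteDimensional ℂ A] (χ : A →ₐ[ℂ] ℂ) {n : ℕ} (hn : 1 ≤ n)
    (hdim : n ≤ Module.finrank ℂ (LinearMap.ker χ.toLinearMap)) {G : Type*} [Group G]
    (ρ : G →* A) (hρ : ∀ g, χ (ρ g) = 1) (f : Fin n → G)
    (hf : Subgroup.closure (Set.range f) = ⊤) :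
    ¬ {x | χ x = 1} ⊆ closure (Set.range ρ) := by
  have : CompleteSpace A := FiniteDimensional.complete ℂ A
  let : NormedAlgebra ℚ A := NormedAlgebra.restrictScalars ℚ ℂ A
  have hχc : Continuous χ := χ.toLinearMap.continuous_of_finiteDimensional
  have hlog : ∀ i, ∃ a : A, exp a = ρ (f i) ∧ χ a = 0 := by
    intro i
    obtain ⟨x, hx⟩ := ((Group.isUnit (f i)).map ρ).exists_exp_eq
    -- The scalar χ x is a period of exp, since exp (χ x) = χ (ρ (f i)) = 1; removing it puts the
    -- logarithm in ker χ.
    refine ⟨x + algebraMap ℂ A (-χ x), ?_, by simp⟩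
    have h1 : Complex.exp (χ x) = 1 := by
      rw [Complex.exp_eq_exp_ℂ, ← map_exp χ hχc, hx, hρ]
    rw [exp_add, hx, ← algebraMap_exp_comm, ← Complex.exp_eq_exp_ℂ, Complex.exp_neg, h1,
      inv_one, map_one, mul_one]
  choose a ha ha0 using hlog
  have hgen : ∀ g : G, ∃ y ∈ AddSubgroup.closure (Set.range a), exp y = ρ g := by
    intro g
    have hg : g ∈ Subgroup.closure (Set.range f) := hf ▸ Subgroup.mem_top g
    induction hg using Subgroup.closure_induction with
    | mem _ h =>
      obtain ⟨i, rfl⟩ := h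
      exact ⟨a i, AddSubgroup.subset_closure ⟨i, rfl⟩, ha i⟩
    | one => exact ⟨0, zero_mem _, by rw [exp_zero, map_one]⟩
    | mul _ _ _ _ hx hy =>
      obtain ⟨x, hx, hx'⟩ := hx
      obtain ⟨y, hy, hy'⟩ := hy
      exact ⟨x + y, add_mem hx hy, by rw [exp_add, hx', hy', map_mul]⟩
    | inv g _ hx =>
      obtain ⟨x, hx, hx'⟩ := hx
      refine ⟨-x, neg_mem hx, ((Group.isUnit g).map ρ).mul_right_cancel ?_⟩
      rw [← map_mul, inv_mul_cancel, map_one, ← hx', ← exp_add, neg_add_cancel, exp_zero]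
  refine fun h => not_subset_closure_exp_image χ hn hdim a ha0 (h.trans (closure_mono ?_))
  rintro _ ⟨g, rfl⟩
  obtain ⟨y, hy, hyg⟩ := hgen g
  exact ⟨y, hy, hyg⟩

/-! ### From affine groups to commutative algebras. -/

section Affine

variable {V : Type*} [NormedAddCommGroup V] [NormedSpace ℂ V] [FiniteDimensional ℂ V]

/-- The action of affine automorphisms of `V` on `V × ℂ` by linear maps preserving the last
coordinate. -/
noncomputable def affineLift : (V ≃ᵃ[ℂ] V) →* ((V × ℂ) →L[ℂ] (V × ℂ)) where
  toFun f := LinearMap.toContinuousLinearMap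
    (((f.linear : V →ₗ[ℂ] V).comp (LinearMap.fst ℂ V ℂ) +
      (LinearMap.snd ℂ V ℂ).smulRight (f 0)).prod (LinearMap.snd ℂ V ℂ))
  map_one' := by
    ext x <;> simp [AffineEquiv.one_def]
  map_mul' f g := by
    have h : ∀ x, f x = f.linear x + f 0 := fun x => by
      simpa using f.map_vadd 0 x
    have hl : ∀ x, (g.trans f).linear x = f.linear (g.linear x) := fun _ => rfl
    ext x <;> simp [hl, AffineEquiv.mul_def, h (g 0)]

theorem affineLift_apply_snd (f : V ≃ᵃ[ℂ] V) (e : V × ℂ) : (affineLift f e).2 = e.2 := by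
  simp [affineLift]

theorem affineLift_apply_one (f : V ≃ᵃ[ℂ] V) (x : V) : affineLift f (x, 1) = (f x, 1) := by
  have h : f x = f.linear x + f 0 := by simpa using f.map_vadd 0 x
  simp [affineLift, h]

/-- An abelian group of affine automorphisms with at most `dim V` generators has no dense orbit. -/
theorem not_dense_orbit_closure {n : ℕ} (hn : 1 ≤ n) (hdim : n ≤ Module.finrank ℂ V)
    (f : Fin n → (V ≃ᵃ[ℂ] V)) (hf : ∀ i j, f i * f j = f j * f i) (v : V) :
    ¬ Dense {x | ∃ g ∈ Subgroup.closure (Set.range f), g v = x} := by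
  intro hdense
  let Γ := Subgroup.closure (Set.range f)
  have hΓ : ∀ g ∈ Γ, ∀ h ∈ Γ, g * h = h * g := by
    have hle : Γ ≤ Subgroup.centralizer (Γ : Set (V ≃ᵃ[ℂ] V)) := by
      rw [Subgroup.centralizer_closure, Subgroup.closure_le]
      rintro _ ⟨i, rfl⟩
      rw [SetLike.mem_coe, Subgroup.mem_centralizer_iff]
      rintro _ ⟨j, rfl⟩
      exact hf j i
    exact fun g hg h hh => (Subgroup.mem_centralizer_iff.1 (hle hg) h hh).symm
  let A := Algebra.adjoin ℂ (affineLift '' (Γ : Set (V ≃ᵃ[ℂ] V)))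
  have hcomm : ∀ a b : A, a * b = b * a := by
    have := Algebra.isMulCommutative_adjoin ℂ (s := affineLift '' (Γ : Set (V ≃ᵃ[ℂ] V))) (by
      rintro _ ⟨g, hg, rfl⟩ _ ⟨h, hh, rfl⟩
      rw [← map_mul, hΓ g hg h hh, map_mul])
    exact fun a b => mul_comm' a b
  let : NormedCommRing A := { (inferInstance : NormedRing A) with mul_comm := hcomm }
  let : NormedAlgebra ℂ A :=
    { (inferInstance : Algebra ℂ A) with
      norm_smul_le := fun r a => norm_smul_le r (a : (V × ℂ) →L[ℂ] (V × ℂ)) }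
  have : FiniteDimensional ℂ A :=
    inferInstanceAs (FiniteDimensional ℂ (Subalgebra.toSubmodule A))
  -- Each element of A scales the last coordinate by a constant, read off at (v, 1); this constant
  -- is the character χ.
  have hlast : ∀ a ∈ A, ∀ e : V × ℂ, (a e).2 = (a (v, 1)).2 * e.2 := by
    intro a ha
    induction ha using Algebra.adjoin_induction with
    | mem _ h =>
      obtain ⟨g, -, rfl⟩ := h
      simp [affineLift_apply_snd]
    | algebraMap r => simp [Algebra.algebraMap_eq_smul_one]
    | add x y _ _ hx hy => intro e; simp [hx e, hy e, add_mul]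
    | mul x y _ _ hx hy =>
      intro e
      rw [mul_apply_eq_comp, mul_apply_eq_comp, hx, hy, hx (y (v, 1))]
      ring
  let ev : A →ₗ[ℂ] V × ℂ :=
    { toFun := fun a => (a : (V × ℂ) →L[ℂ] (V × ℂ)) (v, 1)
      map_add' := fun _ _ => rfl
      map_smul' := fun _ _ => rfl }
  let χ : A →ₐ[ℂ] ℂ := AlgHom.ofLinearMap (LinearMap.snd ℂ V ℂ ∘ₗ ev) rfl
    fun a b => hlast a a.2 _
  have hχ : ∀ a, χ a = (ev a).2 := fun a => rfl
  let ρ : Γ →* A :=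
    { toFun := fun g => ⟨affineLift g, Algebra.subset_adjoin ⟨g, g.2, rfl⟩⟩
      map_one' := Subtype.ext (map_one _)
      map_mul' := fun g h => Subtype.ext (map_mul affineLift (g : V ≃ᵃ[ℂ] V) h) }
  have hevρ : ∀ g, ev (ρ g) = ((g : V ≃ᵃ[ℂ] V) v, 1) := fun g => affineLift_apply_one _ _
  have hcl : ∀ x : V, (x, (1 : ℂ)) ∈ closure (ev '' Set.range ρ) := by
    intro x
    have hc : Continuous fun y : V => (y, (1 : ℂ)) := by fun_prop
    refine closure_mono ?_ (image_closure_subset_closure_image hc ⟨x, hdense x, rfl⟩)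
    rintro _ ⟨_, ⟨g, hg, rfl⟩, rfl⟩
    exact ⟨_, ⟨⟨g, hg⟩, rfl⟩, hevρ _⟩
  have hsurj : Function.Surjective ev := by
    have hclosed : IsClosed (LinearMap.range ev : Set (V × ℂ)) :=
      Submodule.closed_of_finiteDimensional _
    have h1 : ∀ x : V, (x, (1 : ℂ)) ∈ LinearMap.range ev := fun x =>
      closure_minimal (Set.image_subset_range _ _) hclosed (hcl x)
    rw [← LinearMap.range_eq_top, eq_top_iff]
    rintro ⟨x, t⟩ -
    have h2 := add_mem (sub_mem (h1 x) (h1 0)) (Submodule.smul_mem _ t (h1 0))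
    simpa using h2
  -- By commutativity, an element killing the cyclic vector (v, 1) kills everything.
  have hinj : Function.Injective ev := by
    rw [injective_iff_map_eq_zero]
    intro a ha
    ext1
    refine ContinuousLinearMap.ext fun e => ?_
    obtain ⟨b, rfl⟩ := hsurj e
    have h1 : (a : (V × ℂ) →L[ℂ] (V × ℂ)) (ev b) = ev (a * b) := rfl
    have h2 : ev (b * a) = (b : (V × ℂ) →L[ℂ] (V × ℂ)) (ev a) := rfl
    rw [h1, mul_comm, h2, ha]
    simp
  let e : A ≃L[ℂ] V × ℂ := (LinearEquiv.ofBijective ev ⟨hinj, hsurj⟩).toContinuousLinearEquiv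
  have hker : n ≤ Module.finrank ℂ (LinearMap.ker χ.toLinearMap) := by
    have h1 := LinearMap.finrank_range_add_finrank_ker χ.toLinearMap
    have h2 : Module.finrank ℂ A = Module.finrank ℂ V + 1 := by
      rw [e.toLinearEquiv.finrank_eq]
      simp
    have h3 := Submodule.finrank_le (LinearMap.range χ.toLinearMap)
    rw [Module.finrank_self] at h3
    omega
  have hgen : Subgroup.closure
      (Set.range fun i => (⟨f i, Subgroup.subset_closure ⟨i, rfl⟩⟩ : Γ)) = ⊤ := by
    have := Subgroup.closure_closure_coe_preimage (k := Set.range f)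
    convert! this using 2
    ext ⟨x, hx⟩
    simp [Subtype.ext_iff]
  refine not_subset_closure_range_of_fg χ hn hker ρ
    (fun g => by rw [hχ, hevρ]) _ hgen fun a ha => ?_
  have ha1 : (ev a).2 = 1 := ha
  have h1 := hcl (ev a).1
  have h2 : ((ev a).1, (1 : ℂ)) = e a := by rw [← ha1]; rfl
  have h3 : ev '' Set.range ρ = e '' Set.range ρ := rfl
  rw [h2, h3, ← ContinuousLinearEquiv.image_closure] at h1
  exact e.injective.mem_set_image.1 h1

end Affine

/-! ### Semigroup and group orbits. -/

/-- Multiplication of affine maps (and of affine automorphisms) is composition. -/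
theorem corollary1p4 (n : ℕ) (hn : 1 ≤ n)
    (f : Fin n → ((Fin n → ℂ) ≃ᵃ[ℂ] (Fin n → ℂ)))
    (hf : ∀ i j, f i * f j = f j * f i) :
    (∀ 𝒢 : Subsemigroup ((Fin n → ℂ) →ᵃ[ℂ] (Fin n → ℂ)),
      𝒢 = Subsemigroup.closure
        (Set.range fun i => (f i : (Fin n → ℂ) →ᵃ[ℂ] (Fin n → ℂ))) →
      ¬ IsHypercyclic (𝒢 : Set ((Fin n → ℂ) →ᵃ[ℂ] (Fin n → ℂ)))) ∧
    (∀ 𝒢 : Subgroup ((Fin n → ℂ) ≃ᵃ[ℂ] (Fin n → ℂ)),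
      𝒢 = Subgroup.closure (Set.range f) →
      ¬ IsHypercyclic (𝒢 : Set ((Fin n → ℂ) ≃ᵃ[ℂ] (Fin n → ℂ)))) := by
  have key : ∀ v, ¬ Dense {x | ∃ g ∈ Subgroup.closure (Set.range f), g v = x} := fun v =>
    not_dense_orbit_closure hn (by simp) f hf v
  refine ⟨?_, ?_⟩
  · rintro _ rfl ⟨v, hv⟩
    refine key v (hv.mono ?_)
    rintro _ ⟨g, hg, rfl⟩
    suffices h : ∃ γ ∈ Subgroup.closure (Set.range f),
        (γ : (Fin n → ℂ) →ᵃ[ℂ] (Fin n → ℂ)) = g by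
      obtain ⟨γ, hγ, rfl⟩ := h
      exact ⟨γ, hγ, rfl⟩
    induction hg using Subsemigroup.closure_induction with
    | mem _ h =>
      obtain ⟨i, rfl⟩ := h
      exact ⟨f i, Subgroup.subset_closure ⟨i, rfl⟩, rfl⟩
    | mul _ _ _ _ hx hy =>
      obtain ⟨x, hx, rfl⟩ := hx
      obtain ⟨y, hy, rfl⟩ := hy
      exact ⟨x * y, mul_mem hx hy, rfl⟩
  · rintro _ rfl ⟨v, hv⟩
    exact key v hv
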